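/- **Theorem 1.1.** Let $C([0,1])$ be the space of all continuous maps $g:[0,1]\to[0,1]$ with the supremum metric, let $\mu$ be a Borel probability measure on it, and let $\Gamma$ be the topological support of $\mu$. Write $\bigvee_0^1 h\in[0,\infty]$ for the total variation of $h$ on $[0,1]$. Assume (BV) $\quad\mu^{\otimes\mathbb N}\Big(\Big\{(g_1,g_2,\ldots)\in\Gamma^{\mathbb N}:\ \sup_{n\ge1}\bigvee_0^1 (g_1\circ g_2\circ\cdots\circ g_n)<\infty\Big\}\Big)>0.$ A Borel probability measure $\nu$ on $[0,1]$ is called $\mu$-invariant (or $\mu$-stationary) if $\mu*\nu=\nu$, where $\mu*\nu$ is the law of $g(x)$ for independent $g\sim\mu$ and $x\sim\nu$, that is, $\nu(A)=\int_\Gamma\nu(g^{-1}(A))\,\mathrm d\mu(g)$ for all Borel sets $A\subseteq[0,1]$. A $\mu$-invariant probability measure is called ergodic if it is not a proper convex combination of two different $\mu$-invariant probability measures. Supports are topological supports in $[0,1]$. Then: (i) If $\nu_1,\nu_2$ are ergodic $\mu$-invariant Borel probability measures that are concentrated on $(0,1)$ and satisfy $\{0,1\}\cap\operatorname{supp}(\nu_1)\cap\operatorname{supp}(\nu_2)\neq\emptyset$,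 then $\nu_1=\nu_2$. (ii) If there is no $\mu$-invariant probability measure whose support is a finite subset of $(0,1)$, then any two distinct ergodic $\mu$-invariant probability measures $\nu_1,\nu_2$ that are concentrated on $(0,1)$ satisfy $\operatorname{supp}(\nu_1)\cap\operatorname{supp}(\nu_2)=\emptyset$. -/

import Mathlib

open MeasureTheory Set
open scoped unitInterval ENNReal

namespace StochDyn

/-- `randComp ω n = g₁ ∘ g₂ ∘ ⋯ ∘ gₙ` for the sequence `ω = (g₁, g₂, …)`, where `g_{k+1} = ω k`.
The empty composition (`n = 0`) is the identity. -/
def randComp (ω : ℕ → C(I, I)) : ℕ → C(I, I)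
  | 0 => ContinuousMap.id I
  | n + 1 => (randComp ω n).comp (ω n)

/-- Property (BV): with positive probability with respect to the infinite product measure, a
sequence `(g₁, g₂, …)` of elements of the topological support `Γ` of `μ` satisfies
`sup_{n ≥ 1} Var_{[0,1]} (g₁ ∘ ⋯ ∘ gₙ) < ∞`. -/
def HasBV [MeasurableSpace C(I, I)] (μ : Measure C(I, I)) [IsProbabilityMeasure μ] : Prop :=
  0 < Measure.infinitePi (fun _ : ℕ => μ)
    {ω : ℕ → C(I, I) | (∀ k, ω k ∈ μ.support) ∧
      ⨆ n : ℕ, eVariationOn (randComp ω (n + 1)) univ < ∞}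

/-- The convolution `μ ∗ ν`: the law of `g x` for independent `g` with law `μ` and `x` with
law `ν`. -/
noncomputable def conv [MeasurableSpace C(I, I)] (μ : Measure C(I, I)) (ν : Measure I) :
    Measure I :=
  (μ.prod ν).map (fun p : C(I, I) × I => p.1 p.2)

/-- The evaluation map is measurable, so `conv` is a genuine push-forward. -/
theorem measurable_eval [MeasurableSpace C(I, I)] [BorelSpace C(I, I)] :
    Measurable (fun p : C(I, I) × I => p.1 p.2) :=
  continuous_eval.measurable

theorem conv_apply [MeasurableSpace C(I, I)] [BorelSpace C(I, I)] (μ : Measure C(I, I))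
    (ν : Measure I) [SFinite ν] {A : Set I} (hA : MeasurableSet A) :
    conv μ ν A = ∫⁻ g, ν (g ⁻¹' A) ∂μ := by
  rw [conv, Measure.map_apply measurable_eval hA, Measure.prod_apply (measurable_eval hA)]
  rfl

/-- `ν` is a `μ`-stationary (also called `μ`-invariant) Borel probability measure on `[0,1]`. -/
structure IsStationary [MeasurableSpace C(I, I)] (μ : Measure C(I, I)) (ν : Measure I) :
    Prop where
  isProbabilityMeasure : IsProbabilityMeasure ν
  conv_eq : conv μ ν = ν

/-- `ν` is an ergodic `μ`-stationary measure: it is stationary and is not a proper convex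
combination of two different stationary probability measures. -/
structure IsErgodic [MeasurableSpace C(I, I)] (μ : Measure C(I, I)) (ν : Measure I) :
    Prop where
  isStationary : IsStationary μ ν
  extremal : ∀ (ν' ν'' : Measure I) (a b : ℝ≥0∞), IsStationary μ ν' → IsStationary μ ν'' →
    0 < a → 0 < b → a + b = 1 → ν = a • ν' + b • ν'' → ν' = ν''

/-- `ν` gives no mass to the complement of the open interval `(0,1)`. -/
def ConcentratedOnIoo (ν : Measure I) : Prop :=
  ν (Ioo (0 : I) 1)ᶜ = 0

end StochDyn

/-!
Suppose that `ν₁ ≠ ν₂` are ergodic stationary measures. The heart of the argument is that a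
monotone sequence in `[0,1]` cannot alternate between points generic for `ν₁` and points generic
for `ν₂` (`exists_conull_not_alternating`).

To see this, note that `ν₁` and `ν₂` are mutually singular, so for every `ε > 0` there is a
Lipschitz function `h` with values in `[0,1]` whose integral exceeds `1 - ε` for `ν₁` and is below
`ε` for `ν₂`. Write `P` for the Markov operator of `μ`, so that `(P ^ k) h x` is the expectation of
`h (g₁ ∘ ⋯ ∘ gₖ x)`. Averages of `(P ^ k) h` over `k` are close to these two integrals at generic
points, by the mean ergodic theorem in `L²(ν₁)` and `L²(ν₂)` and passage to a common almost
everywhere convergent subsequence. On an event of probability `p > 0` the variation of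
`g₁ ∘ ⋯ ∘ gₖ` is at most `M` for all `k ≥ 1`. For a monotone alternating sequence
`x₀, y₀, x₁, y₁, …` the first `J` differences `h (g₁ ∘ ⋯ ∘ gₖ xⱼ) - h (g₁ ∘ ⋯ ∘ gₖ yⱼ)` thus add up
to at most `L * M` on that event, `L` being the Lipschitz constant, and to at most `J` off it.
Taking expectations and averaging over `k` gives `J * (1 - 2 * ε) ≤ L * M + J * (1 - p)`, which is
absurd for `ε = p / 4` and large `J`.

Hence no point is accumulated from the same side by both measures (`not_accumulate_right`,
`not_accumulate_left`). An endpoint in both supports would be, since neither measure charges it;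
this is the first claim. An accumulation point of the set `S` of common points of the supports would
be as well, so `S` is a finite subset of `(0,1)`. As `μ`-almost every map sends each support into
itself, `S` is invariant, and if it is nonempty, a stationary distribution of the induced finite
Markov chain is a stationary measure with finite support in `(0,1)`; this is the second claim.
-/

namespace StochDyn

open Filter Topology ProbabilityTheory

theorem integrable_continuousMap (ρ : Measure I) [IsFiniteMeasure ρ] (h : C(I, ℝ)) :
    Integrable h ρ :=
  .of_bound h.continuous.aestronglyMeasurable ‖h‖ (Eventually.of_forall h.norm_coe_le_norm)

/-! ### Invariant sets of ergodic stationary measures -/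

section Markov

variable [MeasurableSpace C(I, I)] [BorelSpace C(I, I)] {μ : Measure C(I, I)} {ν : Measure I}

theorem IsStationary.measurePreserving (hν : IsStationary μ ν) :
    MeasurePreserving (fun p : C(I, I) × I => p.1 p.2) (μ.prod ν) ν :=
  ⟨measurable_eval, hν.conv_eq⟩

variable [IsProbabilityMeasure μ]

/-- Conditioning a stationary measure on an invariant set gives a stationary measure. -/
theorem IsStationary.cond (hν : IsStationary μ ν) {B : Set I} (hB : MeasurableSet B)
    (hinv : ∀ᵐ p ∂μ.prod ν, p.1 p.2 ∈ B ↔ p.2 ∈ B) (h0 : ν B ≠ 0) :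
    IsStationary μ (ProbabilityTheory.cond ν B) := by
  have := hν.isProbabilityMeasure
  have hpB := cond_isProbabilityMeasure h0
  refine ⟨hpB, ?_⟩
  ext A hA
  have hprod : μ.prod (ProbabilityTheory.cond ν B)
      = (ν B)⁻¹ • (μ.prod ν).restrict (univ ×ˢ B) := by
    rw [ProbabilityTheory.cond, Measure.prod_smul_right, ← Measure.prod_restrict,
      Measure.restrict_univ]
  rw [conv, Measure.map_apply measurable_eval hA, hprod, ProbabilityTheory.cond,
    Measure.smul_apply, Measure.smul_apply, Measure.restrict_apply (measurable_eval hA),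
    Measure.restrict_apply hA]
  congr 1
  rw [← hν.measurePreserving.measure_preimage (hA.inter hB).nullMeasurableSet]
  refine measure_congr ?_
  filter_upwards [hinv] with p hp
  apply propext
  change ((p.1 p.2 ∈ A) ∧ (p.1 ∈ univ ∧ p.2 ∈ B)) ↔ (p.1 p.2 ∈ A ∧ p.1 p.2 ∈ B)
  simp [hp]

theorem IsErgodic.measure_eq_zero_or_compl (hν : IsErgodic μ ν) {B : Set I}
    (hB : MeasurableSet B) (hinv : ∀ᵐ p ∂μ.prod ν, p.1 p.2 ∈ B ↔ p.2 ∈ B) :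
    ν B = 0 ∨ ν Bᶜ = 0 := by
  have := hν.isStationary.isProbabilityMeasure
  by_contra! h
  have hB1 := hν.isStationary.cond hB hinv h.1
  have hB2 := hν.isStationary.cond hB.compl (hinv.mono fun p hp => not_congr hp) h.2
  have key := hν.extremal _ _ (ν B) (ν Bᶜ) hB1 hB2 (pos_iff_ne_zero.2 h.1)
    (pos_iff_ne_zero.2 h.2) (prob_add_prob_compl hB) (by
      rw [ProbabilityTheory.cond, ProbabilityTheory.cond, smul_smul, smul_smul,
        ENNReal.mul_inv_cancel h.1 (measure_ne_top _ _),
        ENNReal.mul_inv_cancel h.2 (measure_ne_top _ _), one_smul, one_smul,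
        Measure.restrict_add_restrict_compl hB])
  have h1 : ProbabilityTheory.cond ν B B = 1 := cond_apply_self h.1 (measure_ne_top _ _)
  rw [key, cond_apply hB.compl] at h1
  simp at h1

/-- A function that is almost surely constant along the random dynamics is a.e. constant with
respect to an ergodic stationary measure. -/
theorem IsErgodic.ae_eq_const (hν : IsErgodic μ ν) {f : I → ℝ} (hf : Measurable f)
    (hinv : ∀ᵐ p ∂μ.prod ν, f (p.1 p.2) = f p.2) : ∃ c, f =ᵐ[ν] Function.const I c := by
  refine exists_eventuallyEq_const_of_forall_separating MeasurableSet fun U hU => ?_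
  rcases hν.measure_eq_zero_or_compl (hf hU)
    (hinv.mono fun p hp => by simp only [mem_preimage, hp]) with h | h
  · exact Or.inr (measure_eq_zero_iff_ae_notMem.1 h)
  · exact Or.inl ((measure_eq_zero_iff_ae_notMem.1 h).mono fun x hx => by simpa using hx)

/-! ### The Markov operator -/

/-- The Markov operator `h ↦ (x ↦ ∫ h (g x) dμ(g))` on continuous functions. -/
noncomputable def markov (μ : Measure C(I, I)) [IsProbabilityMeasure μ] (h : C(I, ℝ)) :
    C(I, ℝ) where
  toFun x := ∫ g, h (g x) ∂μ
  continuous_toFun := by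
    refine continuous_of_dominated (bound := fun _ => ‖h‖) (fun x => ?_)
      (fun x => Eventually.of_forall fun g => h.norm_coe_le_norm _) (integrable_const _)
      (Eventually.of_forall fun g => by fun_prop)
    exact (h.continuous.comp (continuous_eval_const x)).aestronglyMeasurable

theorem IsStationary.integral_markov (hν : IsStationary μ ν) (h : C(I, ℝ)) :
    ∫ x, markov μ h x ∂ν = ∫ x, h x ∂ν := by
  have := hν.isProbabilityMeasure
  have hint := hν.measurePreserving.integrable_comp_of_integrable (integrable_continuousMap ν h)
  have hswap := integral_prod_symm _ hint
  calc ∫ x, markov μ h x ∂ν = ∫ p, h (p.1 p.2) ∂μ.prod ν := hswap.symm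
    _ = ∫ x, h x ∂ν := by
      conv_rhs => rw [← hν.measurePreserving.map_eq]
      rw [integral_map measurable_eval.aemeasurable h.continuous.aestronglyMeasurable]

theorem IsStationary.integral_markov_iterate (hν : IsStationary μ ν) (h : C(I, ℝ)) (k : ℕ) :
    ∫ x, ((markov μ)^[k] h) x ∂ν = ∫ x, h x ∂ν := by
  induction k with
  | zero => rfl
  | succ k ih => rw [Function.iterate_succ_apply', hν.integral_markov, ih]

/-! ### The mean ergodic theorem -/

/-- The Markov operator on `L²(ν)` is `S† ∘ T` for the isometries `T f (g, x) = f (g x)` and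
`S f (g, x) = f x` into `L²(μ ⊗ ν)`. Its contractivity is then automatic, and its fixed vectors
satisfy `T f = S f`. -/
theorem IsErgodic.tendsto_birkhoffAverage (hν : IsErgodic μ ν) (h : C(I, ℝ)) :
    TendstoInMeasure ν (fun N => (birkhoffAverage ℝ (markov μ) id N h : C(I, ℝ))) atTop
      (fun _ => ∫ x, h x ∂ν) := by
  have := hν.isStationary.isProbabilityMeasure
  have hpT := hν.isStationary.measurePreserving
  have hpS : MeasurePreserving (Prod.snd : C(I, I) × I → I) (μ.prod ν) ν :=
    measurePreserving_snd
  let T : Lp ℝ 2 ν →ₗᵢ[ℝ] Lp ℝ 2 (μ.prod ν) := Lp.compMeasurePreservingₗᵢ ℝ _ hpT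
  let S : Lp ℝ 2 ν →ₗᵢ[ℝ] Lp ℝ 2 (μ.prod ν) := Lp.compMeasurePreservingₗᵢ ℝ _ hpS
  let P : Lp ℝ 2 ν →L[ℝ] Lp ℝ 2 ν :=
    (ContinuousLinearMap.adjoint S.toContinuousLinearMap).comp T.toContinuousLinearMap
  have hP : ‖P‖ ≤ 1 := by
    refine (ContinuousLinearMap.opNorm_comp_le _ _).trans ?_
    rw [LinearIsometryEquiv.norm_map]
    exact mul_le_one₀ S.norm_toContinuousLinearMap_le (norm_nonneg _)
      T.norm_toContinuousLinearMap_le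
  have hTae (f : Lp ℝ 2 ν) : T f =ᵐ[μ.prod ν] fun p => f (p.1 p.2) :=
    Lp.coeFn_compMeasurePreserving f hpT
  have hSae (f : Lp ℝ 2 ν) : S f =ᵐ[μ.prod ν] fun p => f p.2 :=
    Lp.coeFn_compMeasurePreserving f hpS
  let ι : C(I, ℝ) →L[ℝ] Lp ℝ 2 ν := ContinuousMap.toLp 2 ν ℝ
  have hι (f : C(I, ℝ)) : ι f =ᵐ[ν] f := ContinuousMap.coeFn_toLp ν f
  have hPι (f : C(I, ℝ)) : P (ι f) = ι (markov μ f) := by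
    refine ext_inner_left ℝ fun φ => ?_
    have hφ : Integrable φ ν := (Lp.memLp φ).integrable (by norm_num)
    rw [ContinuousLinearMap.comp_apply, ContinuousLinearMap.adjoint_inner_right, L2.inner_def,
      L2.inner_def]
    have h1 : ∀ᵐ p ∂μ.prod ν, inner ℝ ((S φ : Lp ℝ 2 (μ.prod ν)) p) ((T (ι f) : Lp ℝ 2 _) p)
        = φ p.2 * f (p.1 p.2) := by
      filter_upwards [hSae φ, hTae (ι f), hpT.quasiMeasurePreserving.ae (hι f)] with p h1 h2 h3
      rw [h1, h2, h3]
      simp [mul_comm]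
    have h2 : ∀ᵐ x ∂ν, inner ℝ (φ x) (ι (markov μ f) x) = φ x * markov μ f x := by
      filter_upwards [hι (markov μ f)] with x h1
      rw [h1]
      simp [mul_comm]
    refine (integral_congr_ae h1).trans (Eq.trans ?_ (integral_congr_ae h2).symm)
    rw [integral_prod_symm]
    · exact integral_congr_ae (Eventually.of_forall fun x =>
        integral_const_mul (φ x) fun g : C(I, I) => f (g x))
    · refine (hpS.integrable_comp_of_integrable hφ).mul_bdd (c := ‖f‖) ?_ ?_
      · exact (f.measurable.comp measurable_eval).aestronglyMeasurable
      · exact Eventually.of_forall fun p => f.norm_coe_le_norm _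
  have hfix (f : Lp ℝ 2 ν) (hf : P f = f) : ∃ c, f =ᵐ[ν] Function.const I c := by
    -- Equality in Cauchy–Schwarz: `⟪S f, T f⟫ = ⟪f, P f⟫ = ‖f‖²` and both vectors have norm `‖f‖`.
    have hST : T f = S f := by
      have h1 : inner ℝ (S f) (T f) = ‖f‖ ^ 2 := by
        have h2 : inner ℝ f (P f) = inner ℝ (S f) (T f) := by
          rw [ContinuousLinearMap.comp_apply, ContinuousLinearMap.adjoint_inner_right]
          rfl
        rw [← h2, hf, real_inner_self_eq_norm_sq]
      rw [← sub_eq_zero, ← norm_eq_zero, ← sq_eq_zero_iff, norm_sub_sq_real, real_inner_comm, h1,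
        T.norm_map, S.norm_map]
      ring
    obtain ⟨f', hf', hff'⟩ := (Lp.aestronglyMeasurable f)
    obtain ⟨c, hc⟩ := hν.ae_eq_const hf'.measurable (by
      filter_upwards [hTae f, hSae f, hpT.quasiMeasurePreserving.ae hff',
        hpS.quasiMeasurePreserving.ae hff'] with p h1 h2 h3 h4
      rw [← h3, ← h4, ← h1, ← h2, hST])
    exact ⟨c, hff'.trans hc⟩
  have hlim := P.tendsto_birkhoffAverage_orthogonalProjection hP (ι h)
  obtain ⟨c, hc⟩ := hfix _ (((P.eqLocus (1 : Lp ℝ 2 ν →L[ℝ] Lp ℝ 2 ν)).orthogonalProjectionOnto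
    (ι h)).2)
  have hit (k : ℕ) : P^[k] (ι h) = ι ((markov μ)^[k] h) := by
    induction k with
    | zero => rfl
    | succ k ih => rw [Function.iterate_succ_apply', Function.iterate_succ_apply', ih, hPι]
  have havg (N : ℕ) : birkhoffAverage ℝ P id N (ι h) = ι (birkhoffAverage ℝ (markov μ) id N h) := by
    simp only [birkhoffAverage, birkhoffSum, map_smul, map_sum, hit, id]
  simp only [havg] at hlim
  -- The limit constant is identified by integrating.
  have hconst : c = ∫ x, h x ∂ν := by
    have hinner (f : Lp ℝ 2 ν) : inner ℝ (ι 1) f = ∫ x, f x ∂ν := by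
      rw [L2.inner_def]
      refine integral_congr_ae ?_
      filter_upwards [hι 1] with x hx
      rw [hx]
      simp
    have h1 := ((tendsto_const_nhds (x := ι 1)).inner (𝕜 := ℝ) hlim).comp
      (tendsto_add_atTop_nat 1)
    rw [hinner, integral_congr_ae hc] at h1
    simp only [Function.const_apply, integral_const, probReal_univ, one_smul] at h1
    refine tendsto_nhds_unique h1 (tendsto_const_nhds.congr fun N => ?_)
    rw [Function.comp_apply, hinner, integral_congr_ae (hι _)]
    simp only [birkhoffAverage, birkhoffSum, id, ContinuousMap.coe_smul, ContinuousMap.coe_sum,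
      Pi.smul_apply, Finset.sum_apply, smul_eq_mul]
    rw [integral_const_mul, integral_finsetSum _ fun k _ => integrable_continuousMap ν _]
    simp only [hν.isStationary.integral_markov_iterate, Finset.sum_const, Finset.card_range,
      nsmul_eq_mul]
    field_simp
  refine (tendstoInMeasure_of_tendsto_Lp hlim).congr (fun N => hι _) ?_
  rw [← hconst]
  exact hc

end Markov

/-! ### Mutual singularity and almost everywhere convergence -/

section Generic

/-- Mutually singular measures are almost separated by a Lipschitz function. -/
theorem exists_lipschitz_separating {ν₁ ν₂ : Measure I} [IsProbabilityMeasure ν₁]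
    [IsProbabilityMeasure ν₂]
    (hs : ν₁ ⟂ₘ ν₂) {ε : ℝ} (hε : 0 < ε) :
    ∃ (h : C(I, ℝ)) (L : NNReal), LipschitzWith L h ∧ (∀ x, h x ∈ Icc (0 : ℝ) 1) ∧
      1 - ε < ∫ x, h x ∂ν₁ ∧ ∫ x, h x ∂ν₂ < ε := by
  obtain ⟨s, hsm, hs1, hs2⟩ := hs
  obtain ⟨K, hKs, hK, hKν⟩ : ∃ K ⊆ sᶜ, IsCompact K ∧ ν₁ sᶜ < ν₁ K + ENNReal.ofReal ε :=
    hsm.compl.exists_isCompact_lt_add (measure_ne_top _ _) (by simpa using hε)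
  obtain ⟨U, hKU, hU, hUν⟩ : ∃ U ⊇ sᶜ, IsOpen U ∧ ν₂ U < ENNReal.ofReal ε := by
    exact Set.exists_isOpen_lt_of_lt _ _ (by simpa [hs2] using hε)
  obtain ⟨δ, hδ, hδU⟩ := hK.exists_thickening_subset_open hU (hKs.trans hKU)
  have hlip := lipschitzWith_thickenedIndicator hδ K
  let h : C(I, ℝ) := ⟨fun x => thickenedIndicator hδ K x, by fun_prop⟩
  have h01 (x : I) : h x ∈ Icc (0 : ℝ) 1 :=
    ⟨NNReal.coe_nonneg _, by exact_mod_cast thickenedIndicator_le_one hδ K x⟩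
  refine ⟨h, _, fun x y => hlip x y, h01, ?_, ?_⟩
  · have hK1 : 1 - ε < ν₁.real K := by
      have h1 : ν₁ sᶜ = 1 := (prob_compl_eq_one_iff hsm).2 hs1
      rw [h1] at hKν
      have := (ENNReal.toReal_lt_toReal ENNReal.one_ne_top (by finiteness)).2 hKν
      rw [ENNReal.toReal_add (by finiteness) (by finiteness), ENNReal.toReal_ofReal hε.le] at this
      simp only [ENNReal.toReal_one] at this
      rw [Measure.real]; linarith
    refine hK1.trans_le ?_
    rw [← integral_indicator_one hK.measurableSet]
    refine integral_mono ((integrable_const 1).indicator hK.measurableSet)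
      (integrable_continuousMap _ h) fun x => ?_
    by_cases hx : x ∈ K
    · have h1 : h x = 1 := congrArg NNReal.toReal (thickenedIndicator_one hδ K hx)
      simp [hx, h1]
    · simpa [hx] using (h01 x).1
  · have hU1 : ν₂.real U < ε := by
      rw [Measure.real]
      exact ENNReal.toReal_lt_of_lt_ofReal hUν
    refine lt_of_le_of_lt ?_ hU1
    rw [← integral_indicator_one hU.measurableSet]
    refine integral_mono (integrable_continuousMap _ h)
      ((integrable_const 1).indicator hU.measurableSet) fun x => ?_
    by_cases hx : x ∈ U
    · simpa [hx] using (h01 x).2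
    · have h0 : h x = 0 :=
        congrArg NNReal.toReal (thickenedIndicator_zero hδ K fun hx' => hx (hδU hx'))
      simp [hx, h0]

variable [MeasurableSpace C(I, I)] [BorelSpace C(I, I)] {μ : Measure C(I, I)}
  [IsProbabilityMeasure μ] {ν₁ ν₂ : Measure I}

/-- Two ergodic measures admit a common subsequence of times along which the averages of `h`
converge almost everywhere. -/
theorem exists_subseq_tendsto_birkhoffAverage (h₁ : IsErgodic μ ν₁) (h₂ : IsErgodic μ ν₂)
    (h : C(I, ℝ)) : ∃ ns : ℕ → ℕ, Tendsto ns atTop atTop ∧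
      (∀ᵐ x ∂ν₁, Tendsto (fun i => birkhoffAverage ℝ (markov μ) id (ns i) h x) atTop
        (𝓝 (∫ y, h y ∂ν₁))) ∧
      ∀ᵐ x ∂ν₂, Tendsto (fun i => birkhoffAverage ℝ (markov μ) id (ns i) h x) atTop
        (𝓝 (∫ y, h y ∂ν₂)) := by
  obtain ⟨ns, hns, h1⟩ := (h₁.tendsto_birkhoffAverage h).exists_seq_tendsto_ae
  obtain ⟨ms, hms, h2⟩ :=
    ((h₂.tendsto_birkhoffAverage h).comp hns.tendsto_atTop).exists_seq_tendsto_ae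
  exact ⟨ns ∘ ms, hns.tendsto_atTop.comp hms.tendsto_atTop,
    h1.mono fun x hx => hx.comp hms.tendsto_atTop, h2⟩

/-- Averages of a continuous function with different integrals have different limits at generic
points of the two measures. -/
theorem IsErgodic.mutuallySingular (h₁ : IsErgodic μ ν₁) (h₂ : IsErgodic μ ν₂) (hne : ν₁ ≠ ν₂) :
    ν₁ ⟂ₘ ν₂ := by
  have := h₁.isStationary.isProbabilityMeasure
  have := h₂.isStationary.isProbabilityMeasure
  obtain ⟨h, hh⟩ : ∃ h : C(I, ℝ), ∫ y, h y ∂ν₁ ≠ ∫ y, h y ∂ν₂ := by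
    by_contra! hall
    exact hne (ext_of_forall_integral_eq_of_IsFiniteMeasure fun f => hall f.toContinuousMap)
  obtain ⟨ns, -, h1, h2⟩ := exists_subseq_tendsto_birkhoffAverage h₁ h₂ h
  refine Measure.MutuallySingular.mk (ae_iff.1 h1) (ae_iff.1 h2) fun x _ => ?_
  by_contra! hx
  simp only [mem_union, mem_ofPred_eq, not_or, not_not] at hx
  exact hh (tendsto_nhds_unique hx.1 hx.2)

end Generic

/-! ### Random compositions -/

theorem randComp_congr {ω ω' : ℕ → C(I, I)} {n : ℕ} (h : ∀ k < n, ω k = ω' k) :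
    randComp ω n = randComp ω' n := by
  induction n with
  | zero => rfl
  | succ n ih =>
    rw [randComp, randComp, ih fun k hk => h k (by omega), h n (by omega)]

section RandComp

variable [MeasurableSpace C(I, I)] [BorelSpace C(I, I)]

theorem measurable_randComp (n : ℕ) :
    Measurable fun p : (ℕ → C(I, I)) × I => randComp p.1 n p.2 := by
  induction n with
  | zero => exact measurable_snd
  | succ n ih =>
    have h1 : Measurable fun p : (ℕ → C(I, I)) × I => (p.1 n, p.2) := by fun_prop
    exact ih.comp (measurable_fst.prodMk (measurable_eval.comp h1))

/-- The iterates of the Markov operator are expectations over random compositions. -/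
theorem markov_iterate_apply {μ : Measure C(I, I)} [IsProbabilityMeasure μ]
    (h : C(I, ℝ)) (k : ℕ) (x : I) :
    ((markov μ)^[k] h) x
      = ∫ ω, h (randComp ω k x) ∂Measure.infinitePi (fun _ : ℕ => μ) := by
  induction k generalizing x with
  | zero => simp [randComp]
  | succ k ih =>
    set π := Measure.infinitePi (fun _ : ℕ => μ)
    -- `randComp ω k` depends on the first `k` coordinates only, which are independent of `ω k`.
    let R : (ℕ → C(I, I)) → (Finset.range k → C(I, I)) := fun ω i => ω i
    let E : (Finset.range k → C(I, I)) → ℕ → C(I, I) := fun r i =>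
      if hi : i ∈ Finset.range k then r ⟨i, hi⟩ else ContinuousMap.id I
    have hR : Measurable R := by fun_prop
    have hE : Measurable E := by
      refine measurable_pi_lambda _ fun i => ?_
      by_cases hi : i ∈ Finset.range k
      · simp only [E, hi, dif_pos]; fun_prop
      · simp only [E, hi, dif_neg, not_false_eq_true]; fun_prop
    have hER (ω : ℕ → C(I, I)) : randComp (E (R ω)) k = randComp ω k :=
      randComp_congr fun i hi => by simp [E, R, hi]
    have hind : IndepFun R (fun ω : ℕ → C(I, I) => ω k) π := by
      have h1 : iIndepFun (fun (i : ℕ) (ω : ℕ → C(I, I)) => ω i) π :=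
        iIndepFun_infinitePi (X := fun _ g => g) fun _ => measurable_id
      have h2 := h1.indepFun_finset (Finset.range k) {k} (by simp) fun i => by fun_prop
      exact h2.comp measurable_id (measurable_pi_apply (⟨k, by simp⟩ : ({k} : Finset ℕ)))
    have hlaw := (indepFun_iff_map_prod_eq_prod_map_map hR.aemeasurable
      (measurable_pi_apply k).aemeasurable).1 hind
    rw [show π.map (fun ω => ω k) = μ from Measure.infinitePi_map_eval _ k] at hlaw
    have : IsProbabilityMeasure (π.map R) := Measure.isProbabilityMeasure_map hR.aemeasurable
    have hm : Measurable fun p : (Finset.range k → C(I, I)) × C(I, I) =>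
        h (randComp (E p.1) k (p.2 x)) := by
      refine h.measurable.comp ((measurable_randComp k).comp
        ((hE.comp measurable_fst).prodMk ?_))
      exact measurable_eval.comp (measurable_snd.prodMk measurable_const)
    symm
    calc ∫ ω, h (randComp ω (k + 1) x) ∂π
        = ∫ ω, h (randComp (E (R ω)) k (ω k x)) ∂π := by simp only [hER]; rfl
      _ = ∫ p, h (randComp (E p.1) k (p.2 x)) ∂(π.map R).prod μ := by
        rw [← hlaw, integral_map (by fun_prop) hm.aestronglyMeasurable]
      _ = ∫ g, ∫ r, h (randComp (E r) k (g x)) ∂(π.map R) ∂μ := by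
        refine integral_prod_symm _ (.of_bound hm.aestronglyMeasurable ‖h‖ ?_)
        exact Eventually.of_forall fun p => h.norm_coe_le_norm _
      _ = ∫ g, ((markov μ)^[k] h) (g x) ∂μ := by
        refine integral_congr_ae (Eventually.of_forall fun g => ?_)
        have hm' : Measurable fun r => h (randComp (E r) k (g x)) :=
          h.measurable.comp ((measurable_randComp k).comp (hE.prodMk measurable_const))
        simp only
        rw [ih, integral_map hR.aemeasurable hm'.aestronglyMeasurable]
        simp only [hER]
      _ = ((markov μ)^[k + 1] h) x := by rw [Function.iterate_succ_apply']; rfl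

end RandComp

/-! ### Alternating monotone sequences of generic points -/

section Alternating

theorem sum_edist_le_eVariationOn {f : I → I} {u : ℕ → I} (hu : Monotone u ∨ Antitone u)
    (n : ℕ) : ∑ i ∈ Finset.range n, edist (f (u (i + 1))) (f (u i)) ≤ eVariationOn f univ := by
  rcases hu with hu | hu
  · exact eVariationOn.sum_le hu fun _ => mem_univ _
  · rw [← eVariationOn.comp_ofDual]
    exact eVariationOn.sum_le (f := f ∘ OrderDual.ofDual)
      (u := fun i => OrderDual.toDual (u i)) (fun i j hij => hu hij) fun _ => mem_univ _

/-- Along a monotone sequence `u`, the differences of an `L`-Lipschitz observable over the disjoint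
intervals between `u (2 * j)` and `u (2 * j + 1)` add up to at most `L` times the variation. -/
theorem sum_abs_sub_le {f : I → I} {u : ℕ → I} (hu : Monotone u ∨ Antitone u) {M : ℝ}
    (hM : 0 ≤ M) (hf : eVariationOn f univ ≤ ENNReal.ofReal M) {h : I → ℝ} {L : NNReal}
    (hL : LipschitzWith L h) (J : ℕ) :
    ∑ j ∈ Finset.range J, |h (f (u (2 * j))) - h (f (u (2 * j + 1)))| ≤ L * M := by
  have h1 : ∑ i ∈ Finset.range (2 * J), dist (f (u (i + 1))) (f (u i)) ≤ M := by
    rw [← ENNReal.ofReal_le_ofReal_iff hM, ENNReal.ofReal_sum_of_nonneg fun _ _ => dist_nonneg]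
    simp only [← edist_dist]
    exact (sum_edist_le_eVariationOn hu _).trans hf
  have h2 : ∑ j ∈ Finset.range J, dist (f (u (2 * j + 1))) (f (u (2 * j)))
      ≤ ∑ i ∈ Finset.range (2 * J), dist (f (u (i + 1))) (f (u i)) := by
    induction J with
    | zero => simp
    | succ J ih =>
      rw [Finset.sum_range_succ, Nat.mul_succ, Finset.sum_range_succ, Finset.sum_range_succ]
      have h3 : ∑ i ∈ Finset.range (2 * J), dist (f (u (i + 1))) (f (u i)) ≤ M := by
        refine le_trans ?_ h1
        exact Finset.sum_le_sum_of_subset_of_nonneg (Finset.range_mono (by omega))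
          fun _ _ _ => dist_nonneg
      linarith [ih h3, dist_nonneg (x := f (u (2 * J + 1 + 1))) (y := f (u (2 * J + 1)))]
  calc ∑ j ∈ Finset.range J, |h (f (u (2 * j))) - h (f (u (2 * j + 1)))|
      ≤ ∑ j ∈ Finset.range J, L * dist (f (u (2 * j + 1))) (f (u (2 * j))) :=
        Finset.sum_le_sum fun j _ => by
          rw [← Real.dist_eq, dist_comm (f _)]; exact hL.dist_le_mul _ _
    _ = L * ∑ j ∈ Finset.range J, dist (f (u (2 * j + 1))) (f (u (2 * j))) := by
        rw [Finset.mul_sum]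
    _ ≤ L * M := by gcongr; exact h2.trans h1

theorem HasBV.exists_uniform_bound [MeasurableSpace C(I, I)] {μ : Measure C(I, I)}
    [IsProbabilityMeasure μ] (hBV : HasBV μ) :
    ∃ M : ℕ, 0 < Measure.infinitePi (fun _ : ℕ => μ)
      {ω | ∀ n, eVariationOn (randComp ω (n + 1)) univ ≤ ENNReal.ofReal M} := by
  by_contra! hM
  refine hBV.ne' (measure_mono_null ?_
    (measure_iUnion_null fun M => nonpos_iff_eq_zero.1 (hM M)))
  rintro ω ⟨-, hω⟩
  obtain ⟨M, hMω⟩ := ENNReal.exists_nat_gt hω.ne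
  refine mem_iUnion.2 ⟨M, fun n => ?_⟩
  rw [ENNReal.ofReal_natCast]
  exact (le_iSup (fun n => eVariationOn (randComp ω (n + 1)) univ) n).trans hMω.le

variable [MeasurableSpace C(I, I)] [BorelSpace C(I, I)] {μ : Measure C(I, I)}
  [IsProbabilityMeasure μ] {ν₁ ν₂ : Measure I}

/-- Where the variations are bounded by `M`, the `J` differences add up to at most `L * M`;
elsewhere each of them is at most `1`. The event need not be measurable, and its probability is
understood as an outer measure. -/
theorem sum_markov_sub_le {M : ℕ} {u : ℕ → I} (hu : Monotone u ∨ Antitone u) {h : C(I, ℝ)}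
    {L : NNReal} (hL : LipschitzWith L h) (h01 : ∀ x, h x ∈ Icc (0 : ℝ) 1) (J k : ℕ) :
    ∑ j ∈ Finset.range J, (((markov μ)^[k + 1] h) (u (2 * j))
        - ((markov μ)^[k + 1] h) (u (2 * j + 1)))
      ≤ L * M + J * (1 - (Measure.infinitePi (fun _ : ℕ => μ)).real
        {ω | ∀ n, eVariationOn (randComp ω (n + 1)) univ ≤ ENNReal.ofReal M}) := by
  set π := Measure.infinitePi (fun _ : ℕ => μ)
  let Y : I → (ℕ → C(I, I)) → ℝ := fun x ω => h (randComp ω (k + 1) x)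
  have hY (x : I) : Measurable (Y x) := h.measurable.comp
    ((measurable_randComp (k + 1)).comp (measurable_id.prodMk measurable_const))
  have hYi (x : I) : Integrable (Y x) π := .of_bound (hY x).aestronglyMeasurable ‖h‖
    (Eventually.of_forall fun _ => h.norm_coe_le_norm _)
  let F : (ℕ → C(I, I)) → ℝ := fun ω =>
    ∑ j ∈ Finset.range J, (Y (u (2 * j)) ω - Y (u (2 * j + 1)) ω)
  have hF : Measurable F := Finset.measurable_sum _ fun j _ => (hY _).sub (hY _)
  have hFi : Integrable F π := integrable_finsetSum _ fun j _ => (hYi _).sub (hYi _)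
  -- A measurable event that contains the possibly non-measurable one.
  let D : Set (ℕ → C(I, I)) := {ω | F ω ≤ L * M}
  have hD : MeasurableSet D := measurableSet_le hF measurable_const
  have hsub : {ω | ∀ n, eVariationOn (randComp ω (n + 1)) univ ≤ ENNReal.ofReal M} ⊆ D :=
    fun ω hω => (Finset.sum_le_sum fun j _ => le_abs_self _).trans
      (sum_abs_sub_le hu (Nat.cast_nonneg M) (hω k) hL J)
  have hpt (ω : ℕ → C(I, I)) : F ω ≤ L * M + Dᶜ.indicator (fun _ => (J : ℝ)) ω := by
    by_cases hω : ω ∈ D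
    · have hω' : F ω ≤ L * M := hω
      simpa [hω] using hω'
    · have h1 : F ω ≤ ∑ j ∈ Finset.range J, (1 : ℝ) := Finset.sum_le_sum fun j _ => by
        have ha := (h01 (randComp ω (k + 1) (u (2 * j)))).2
        have hb := (h01 (randComp ω (k + 1) (u (2 * j + 1)))).1
        simp only [Y]; linarith
      have h2 : (0 : ℝ) ≤ L * M := by positivity
      simp only [mem_compl_iff, hω, not_false_eq_true, indicator_of_mem]
      simp only [Finset.sum_const, Finset.card_range, nsmul_eq_mul, mul_one] at h1
      linarith
  have hint : ∫ ω, F ω ∂π ≤ L * M + J * π.real Dᶜ := by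
    have hi := (integrable_const (μ := π) (J : ℝ)).indicator hD.compl
    refine (integral_mono hFi ((integrable_const _).add hi) hpt).trans ?_
    simp only [Pi.add_apply]
    rw [integral_add (integrable_const _) hi, integral_indicator_const _ hD.compl]
    simp [mul_comm]
  have hF_eq : ∫ ω, F ω ∂π = ∑ j ∈ Finset.range J, (((markov μ)^[k + 1] h) (u (2 * j))
        - ((markov μ)^[k + 1] h) (u (2 * j + 1))) := by
    refine (integral_finsetSum _ fun j _ => (hYi (u (2 * j))).sub (hYi (u (2 * j + 1)))).trans ?_
    refine Finset.sum_congr rfl fun j _ => ?_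
    rw [markov_iterate_apply, markov_iterate_apply]
    exact integral_sub (hYi _) (hYi _)
  rw [← hF_eq]
  refine hint.trans ?_
  rw [probReal_compl_eq_one_sub hD]
  gcongr
  exact measure_ne_top _ _

/-- Two distinct ergodic measures have conull sets `G₁` and `G₂` of generic points between which no
monotone sequence alternates. -/
theorem exists_conull_not_alternating (hBV : HasBV μ) (h₁ : IsErgodic μ ν₁)
    (h₂ : IsErgodic μ ν₂) (hne : ν₁ ≠ ν₂) :
    ∃ G₁ G₂ : Set I, (∀ᵐ x ∂ν₁, x ∈ G₁) ∧ (∀ᵐ x ∂ν₂, x ∈ G₂) ∧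
      ∀ u : ℕ → I, (Monotone u ∨ Antitone u) →
        ¬ ∀ j, u (2 * j) ∈ G₁ ∧ u (2 * j + 1) ∈ G₂ := by
  have := h₁.isStationary.isProbabilityMeasure
  have := h₂.isStationary.isProbabilityMeasure
  obtain ⟨M, hM⟩ := hBV.exists_uniform_bound
  set p := (Measure.infinitePi (fun _ : ℕ => μ)).real
    {ω | ∀ n, eVariationOn (randComp ω (n + 1)) univ ≤ ENNReal.ofReal M}
  have hp : 0 < p := ENNReal.toReal_pos hM.ne' (measure_ne_top _ _)
  have hp1 : p ≤ 1 := measureReal_le_one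
  -- With `p / 4` the two integrals differ by more than `1 - p / 2`, which beats `1 - p`.
  obtain ⟨h, L, hL, h01, hc₁, hc₂⟩ :=
    exists_lipschitz_separating (h₁.mutuallySingular h₂ hne) (ε := p / 4) (by positivity)
  -- The time origin is shifted by one since the bound on the variation starts at one map.
  obtain ⟨ns, -, hG₁, hG₂⟩ := exists_subseq_tendsto_birkhoffAverage h₁ h₂ (markov μ h)
  rw [h₁.isStationary.integral_markov] at hG₁
  rw [h₂.isStationary.integral_markov] at hG₂
  refine ⟨{x | Tendsto (fun i => birkhoffAverage ℝ (markov μ) id (ns i) (markov μ h) x) atTop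
      (𝓝 (∫ y, h y ∂ν₁))},
    {x | Tendsto (fun i => birkhoffAverage ℝ (markov μ) id (ns i) (markov μ h) x) atTop
      (𝓝 (∫ y, h y ∂ν₂))}, hG₁, hG₂, fun u hu hG => ?_⟩
  have key (J : ℕ) : J * (p / 2) ≤ L * M := by
    have hle (N : ℕ) : ∑ j ∈ Finset.range J,
        (birkhoffAverage ℝ (markov μ) id N (markov μ h) (u (2 * j))
          - birkhoffAverage ℝ (markov μ) id N (markov μ h) (u (2 * j + 1)))
        ≤ L * M + J * (1 - p) := by
      have hb : 0 ≤ L * M + J * (1 - p) := by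
        have : 0 ≤ 1 - p := by linarith
        positivity
      have heq : ∑ j ∈ Finset.range J,
          (birkhoffAverage ℝ (markov μ) id N (markov μ h) (u (2 * j))
            - birkhoffAverage ℝ (markov μ) id N (markov μ h) (u (2 * j + 1)))
          = (N : ℝ)⁻¹ * ∑ k ∈ Finset.range N, ∑ j ∈ Finset.range J,
            (((markov μ)^[k + 1] h) (u (2 * j)) - ((markov μ)^[k + 1] h) (u (2 * j + 1))) := by
        simp only [birkhoffAverage, birkhoffSum, id, ContinuousMap.coe_smul,
          ContinuousMap.coe_sum, Pi.smul_apply, Finset.sum_apply, smul_eq_mul, ← mul_sub,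
          ← Finset.mul_sum, ← Finset.sum_sub_distrib, Function.iterate_succ_apply]
        rw [Finset.sum_comm]
      rw [heq]
      rcases Nat.eq_zero_or_pos N with rfl | hN
      · simpa using hb
      · rw [inv_mul_le_iff₀ (by exact_mod_cast hN)]
        refine (Finset.sum_le_card_nsmul _ _ _ fun k _ =>
          sum_markov_sub_le (M := M) hu hL h01 J k).trans_eq ?_
        rw [Finset.card_range, nsmul_eq_mul]
    have hlim := le_of_tendsto' (tendsto_finsetSum (Finset.range J) fun j _ =>
      Tendsto.sub (hG j).1 (hG j).2) fun i => hle (ns i)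
    rw [Finset.sum_const, Finset.card_range, nsmul_eq_mul] at hlim
    have hJ : (J : ℝ) * (1 - p / 2) ≤ J * (∫ y, h y ∂ν₁ - ∫ y, h y ∂ν₂) :=
      mul_le_mul_of_nonneg_left (by linarith) (Nat.cast_nonneg J)
    linarith
  obtain ⟨J, hJ⟩ := exists_nat_gt (L * M / (p / 2))
  rw [div_lt_iff₀ (by positivity)] at hJ
  exact absurd (key J) (not_le.2 hJ)

end Alternating

/-! ### Common points of the supports -/

/-- If `G₁` and `G₂` can both be reached along `r` from every point of `A` without leaving `A`, then
some `r`-chain alternates between them. -/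
theorem exists_alternating_seq {α : Type*} {r : α → α → Prop} {A G₁ G₂ : Set α}
    (hA : A.Nonempty) (h₁ : ∀ y ∈ A, ∃ z ∈ A, r y z ∧ z ∈ G₁)
    (h₂ : ∀ y ∈ A, ∃ z ∈ A, r y z ∧ z ∈ G₂) :
    ∃ u : ℕ → α, (∀ n, r (u n) (u (n + 1))) ∧ ∀ j, u (2 * j) ∈ G₁ ∧ u (2 * j + 1) ∈ G₂ := by
  obtain ⟨a, ha⟩ := hA
  have hstep (n : ℕ) (y : A) : ∃ z : A, r y z ∧ (z : α) ∈ if Even n then G₁ else G₂ := by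
    split_ifs
    · obtain ⟨z, hz, h⟩ := h₁ y y.2
      exact ⟨⟨z, hz⟩, h⟩
    · obtain ⟨z, hz, h⟩ := h₂ y y.2
      exact ⟨⟨z, hz⟩, h⟩
  choose step hr hG using hstep
  let v : ℕ → A := fun n => Nat.rec (step 0 ⟨a, ha⟩) (fun n y => step (n + 1) y) n
  have hv (n : ℕ) : (v n).1 ∈ if Even n then G₁ else G₂ := by
    cases n with
    | zero => exact hG 0 _
    | succ n => exact hG (n + 1) _
  refine ⟨fun n => (v n).1, fun n => hr (n + 1) (v n), fun j => ⟨?_, ?_⟩⟩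
  · simpa using hv (2 * j)
  · simpa using hv (2 * j + 1)

/-- A property that holds almost everywhere holds somewhere on each set of positive measure. -/
theorem exists_mem_of_measure_pos {ρ : Measure I} {A G : Set I} (hG : ∀ᵐ x ∂ρ, x ∈ G)
    (hA : 0 < ρ A) : ∃ x ∈ A, x ∈ G := by
  obtain ⟨x, hx⟩ := (frequently_ae_mem_iff.2 hA.ne').and_eventually hG |>.exists
  exact ⟨x, hx⟩

section Accumulation

variable [MeasurableSpace C(I, I)] [BorelSpace C(I, I)] {μ : Measure C(I, I)}
  [IsProbabilityMeasure μ] {ν₁ ν₂ : Measure I}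

/-- The points to the right of `x` have to exist, as the condition is vacuous for `x = 1`. -/
theorem not_accumulate_right (hBV : HasBV μ) (h₁ : IsErgodic μ ν₁) (h₂ : IsErgodic μ ν₂)
    (hne : ν₁ ≠ ν₂) {x : I} (hx : (Ioi x).Nonempty) :
    ¬ ∀ y > x, 0 < ν₁ (Ioo x y) ∧ 0 < ν₂ (Ioo x y) := by
  intro hpos
  obtain ⟨G₁, G₂, hG₁, hG₂, halt⟩ := exists_conull_not_alternating hBV h₁ h₂ hne
  obtain ⟨u, hu, huG⟩ := exists_alternating_seq (r := fun y z => z ≤ y) (G₁ := G₁) (G₂ := G₂) hx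
    (fun y hy => by
      obtain ⟨z, hz, hzG⟩ := exists_mem_of_measure_pos hG₁ (hpos y hy).1
      exact ⟨z, hz.1, hz.2.le, hzG⟩)
    (fun y hy => by
      obtain ⟨z, hz, hzG⟩ := exists_mem_of_measure_pos hG₂ (hpos y hy).2
      exact ⟨z, hz.1, hz.2.le, hzG⟩)
  exact halt u (Or.inr (antitone_nat_of_succ_le hu)) huG

theorem not_accumulate_left (hBV : HasBV μ) (h₁ : IsErgodic μ ν₁) (h₂ : IsErgodic μ ν₂)
    (hne : ν₁ ≠ ν₂) {x : I} (hx : (Iio x).Nonempty) :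
    ¬ ∀ y < x, 0 < ν₁ (Ioo y x) ∧ 0 < ν₂ (Ioo y x) := by
  intro hpos
  obtain ⟨G₁, G₂, hG₁, hG₂, halt⟩ := exists_conull_not_alternating hBV h₁ h₂ hne
  obtain ⟨u, hu, huG⟩ := exists_alternating_seq (r := fun y z => y ≤ z) (G₁ := G₁) (G₂ := G₂) hx
    (fun y hy => by
      obtain ⟨z, hz, hzG⟩ := exists_mem_of_measure_pos hG₁ (hpos y hy).1
      exact ⟨z, hz.2, hz.1.le, hzG⟩)
    (fun y hy => by
      obtain ⟨z, hz, hzG⟩ := exists_mem_of_measure_pos hG₂ (hpos y hy).2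
      exact ⟨z, hz.2, hz.1.le, hzG⟩)
  exact halt u (Or.inl (monotone_nat_of_le_succ hu)) huG

/-- A common point of the supports that neither measure charges would be accumulated by both
measures from the only available side if it were an endpoint. -/
theorem mem_Ioo_of_mem_support (hBV : HasBV μ) (h₁ : IsErgodic μ ν₁) (hc₁ : ConcentratedOnIoo ν₁)
    (h₂ : IsErgodic μ ν₂) (hc₂ : ConcentratedOnIoo ν₂) (hne : ν₁ ≠ ν₂) {x : I}
    (hx₁ : x ∈ ν₁.support) (hx₂ : x ∈ ν₂.support) : x ∈ Ioo (0 : I) 1 := by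
  have hpos {ρ : Measure I} (hc : ConcentratedOnIoo ρ) {z : I} (hz : z ∈ ρ.support) {U : Set I}
      (hU : IsOpen U) (hzU : z ∈ U) : 0 < ρ (U ∩ Ioo 0 1) := by
    rw [measure_inter_conull hc]
    exact (Measure.mem_support_iff_forall z).1 hz U (hU.mem_nhds hzU)
  refine ⟨unitInterval.pos_iff_ne_zero.2 ?_, unitInterval.lt_one_iff_ne_one.2 ?_⟩
  · rintro rfl
    refine not_accumulate_right hBV h₁ h₂ hne (x := 0) ⟨1, mem_Ioi.2 zero_lt_one⟩ fun y hy => ?_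
    exact ⟨(hpos hc₁ hx₁ isOpen_Iio hy).trans_le (measure_mono fun z hz => ⟨hz.2.1, hz.1⟩),
      (hpos hc₂ hx₂ isOpen_Iio hy).trans_le (measure_mono fun z hz => ⟨hz.2.1, hz.1⟩)⟩
  · rintro rfl
    refine not_accumulate_left hBV h₁ h₂ hne (x := 1) ⟨0, mem_Iio.2 zero_lt_one⟩ fun y hy => ?_
    exact ⟨(hpos hc₁ hx₁ isOpen_Ioi hy).trans_le (measure_mono fun z hz => ⟨hz.1, hz.2.2⟩),
      (hpos hc₂ hx₂ isOpen_Ioi hy).trans_le (measure_mono fun z hz => ⟨hz.1, hz.2.2⟩)⟩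

/-- Near an accumulation point of the common points, both measures charge every punctured one-sided
neighbourhood on one of the two sides. -/
theorem finite_inter_support (hBV : HasBV μ) (h₁ : IsErgodic μ ν₁) (h₂ : IsErgodic μ ν₂)
    (hne : ν₁ ≠ ν₂) : (ν₁.support ∩ ν₂.support).Finite := by
  by_contra hinf
  obtain ⟨x, hx⟩ := Set.Infinite.exists_accPt_principal hinf
  rw [accPt_iff_frequently_nhdsNE, ← nhdsLT_sup_nhdsGT, frequently_sup] at hx
  have hpos {U : Set I} (hU : IsOpen U) {s : I} (hs : s ∈ ν₁.support ∩ ν₂.support) (hsU : s ∈ U) :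
      0 < ν₁ U ∧ 0 < ν₂ U :=
    ⟨(Measure.mem_support_iff_forall s).1 hs.1 U (hU.mem_nhds hsU),
      (Measure.mem_support_iff_forall s).1 hs.2 U (hU.mem_nhds hsU)⟩
  rcases hx with hx | hx
  · obtain ⟨y, -, hy⟩ := (hx.and_eventually self_mem_nhdsWithin).exists
    refine not_accumulate_left hBV h₁ h₂ hne ⟨y, hy⟩ fun z hz => ?_
    obtain ⟨s, hs, hsz⟩ := (hx.and_eventually (Ioo_mem_nhdsLT hz)).exists
    exact hpos isOpen_Ioo hs hsz
  · obtain ⟨y, -, hy⟩ := (hx.and_eventually self_mem_nhdsWithin).exists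
    refine not_accumulate_right hBV h₁ h₂ hne ⟨y, hy⟩ fun z hz => ?_
    obtain ⟨s, hs, hsz⟩ := (hx.and_eventually (Ioo_mem_nhdsGT hz)).exists
    exact hpos isOpen_Ioo hs hsz

end Accumulation

theorem IsStationary.ae_mapsTo_support [MeasurableSpace C(I, I)] [BorelSpace C(I, I)]
    {μ : Measure C(I, I)} {ν : Measure I} (hν : IsStationary μ ν) :
    ∀ᵐ g : C(I, I) ∂μ, MapsTo g ν.support ν.support := by
  have := hν.isProbabilityMeasure
  have h0 : ∫⁻ g, ν (g ⁻¹' ν.supportᶜ) ∂μ = 0 := by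
    rw [← conv_apply μ ν Measure.isOpen_compl_support.measurableSet, hν.conv_eq,
      Measure.measure_compl_support]
  have hm : Measurable fun g : C(I, I) => ν (g ⁻¹' ν.supportᶜ) :=
    measurable_measure_prodMk_left
      (measurable_eval Measure.isOpen_compl_support.measurableSet)
  rw [lintegral_eq_zero_iff hm] at h0
  filter_upwards [h0] with g hg x hx
  by_contra hgx
  exact Measure.subset_compl_support_of_isOpen
    (Measure.isOpen_compl_support.preimage g.continuous) hg hgx hx

/-! ### Stationary measures on finite invariant sets -/

/-- A stochastic matrix has a stationary distribution: the absolute value of a left eigenvector for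
the eigenvalue `1` is subinvariant, and its total mass is preserved. -/
theorem exists_stationary_vector {n : Type*} [Fintype n] [DecidableEq n] [Nonempty n]
    (p : Matrix n n ℝ) (hp : ∀ s t, 0 ≤ p s t) (hp1 : ∀ s, ∑ t, p s t = 1) :
    ∃ w : n → ℝ, (∀ s, 0 ≤ w s) ∧ ∑ s, w s = 1 ∧ ∀ t, ∑ s, w s * p s t = w t := by
  obtain ⟨v, hv0, hv⟩ : ∃ v ≠ 0, Matrix.vecMul v (p - 1) = 0 := by
    rw [Matrix.exists_vecMul_eq_zero_iff, ← Matrix.exists_mulVec_eq_zero_iff]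
    refine ⟨1, one_ne_zero, ?_⟩
    ext s
    rw [Matrix.sub_mulVec, Matrix.one_mulVec]
    simp [Matrix.mulVec, dotProduct, hp1]
  have hv' (t : n) : ∑ s, v s * p s t = v t := by
    have := congrFun hv t
    rw [Matrix.vecMul_sub, Matrix.vecMul_one, Pi.sub_apply, Pi.zero_apply, sub_eq_zero] at this
    exact this
  have hle (t : n) : |v t| ≤ ∑ s, |v s| * p s t := by
    conv_lhs => rw [← hv' t]
    refine (Finset.abs_sum_le_sum_abs _ _).trans_eq (Finset.sum_congr rfl fun s _ => ?_)
    rw [abs_mul, abs_of_nonneg (hp s t)]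
  have hsum : ∑ t, |v t| = ∑ t, ∑ s, |v s| * p s t := by
    rw [Finset.sum_comm]
    simp only [← Finset.mul_sum, hp1, mul_one]
  have heq (t : n) : |v t| = ∑ s, |v s| * p s t :=
    (Finset.sum_eq_sum_iff_of_le fun t _ => hle t).1 hsum t (Finset.mem_univ t)
  have hpos : 0 < ∑ s, |v s| := by
    obtain ⟨s, hs⟩ := Function.ne_iff.1 hv0
    exact Finset.sum_pos' (fun s _ => abs_nonneg _) ⟨s, Finset.mem_univ s, abs_pos.2 hs⟩
  refine ⟨fun s => |v s| / ∑ s, |v s|, fun s => by positivity, ?_, fun t => ?_⟩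
  · rw [← Finset.sum_div, div_self hpos.ne']
  · simp only [div_mul_eq_mul_div]
    rw [← Finset.sum_div, ← heq]

/-- A nonempty finite set that almost every map sends into itself carries a stationary measure,
namely a stationary distribution of the induced Markov chain. -/
theorem exists_isStationary_of_finite [MeasurableSpace C(I, I)] [BorelSpace C(I, I)]
    {μ : Measure C(I, I)} [IsProbabilityMeasure μ] {S : Set I} (hS : S.Finite)
    (hne : S.Nonempty) (hinv : ∀ᵐ g : C(I, I) ∂μ, MapsTo g S S) :
    ∃ ν : Measure I, IsStationary μ ν ∧ ν.support ⊆ S := by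
  classical
  have := hS.fintype
  have := hne.to_subtype
  have hmeas (s : I) : Measurable fun g : C(I, I) => g s :=
    (continuous_eval_const s).measurable
  have hset (s : I) {A : Set I} (hA : MeasurableSet A) :
      MeasurableSet {g : C(I, I) | g s ∈ A} := hmeas s hA
  let q : S → S → ℝ≥0∞ := fun s t => μ {g | g s = t}
  have hq (s t : S) : MeasurableSet {g : C(I, I) | g s = t} := hset s (measurableSet_singleton _)
  have hqA (s : S) {A : Set I} (hA : MeasurableSet A) :
      μ {g | g s ∈ A} = ∑ t : S, A.indicator 1 (t : I) * q s t := by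
    have h1 : ∀ᵐ g ∂μ, {g : C(I, I) | g s ∈ A}.indicator (1 : C(I, I) → ℝ≥0∞) g
        = ∑ t : S, A.indicator 1 (t : I) * {g : C(I, I) | g s = t}.indicator 1 g := by
      filter_upwards [hinv] with g hg
      rw [Finset.sum_eq_single (⟨g s, hg s.2⟩ : S)]
      · simp [indicator]
      · intro t _ ht
        have : g s ≠ t := fun h => ht (Subtype.ext h.symm)
        simp [indicator, this]
      · simp
    rw [← lintegral_indicator_one (hset s hA), lintegral_congr_ae h1,
      lintegral_finsetSum _ fun t _ => (measurable_one.indicator (hq s t)).const_mul _]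
    refine Finset.sum_congr rfl fun t _ => ?_
    rw [lintegral_const_mul _ (measurable_one.indicator (hq s t)),
      lintegral_indicator_one (hq s t)]
  obtain ⟨w, hw0, hw1, hw⟩ := exists_stationary_vector (fun s t => (q s t).toReal)
    (fun _ _ => ENNReal.toReal_nonneg) fun s => by
      rw [← ENNReal.toReal_sum fun _ _ => measure_ne_top _ _]
      have h1 := hqA s MeasurableSet.univ
      simp only [indicator_univ, Pi.one_apply, one_mul] at h1
      rw [← h1, show {g : C(I, I) | g s ∈ univ} = univ from eq_univ_of_forall fun _ => mem_univ _,
        measure_univ, ENNReal.toReal_one]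
  let W : S → ℝ≥0∞ := fun s => ENNReal.ofReal (w s)
  have hW (t : S) : ∑ s, W s * q s t = W t := by
    simp only [W]
    rw [← hw t, ENNReal.ofReal_sum_of_nonneg fun s _ => mul_nonneg (hw0 s) ENNReal.toReal_nonneg]
    refine Finset.sum_congr rfl fun s _ => ?_
    rw [ENNReal.ofReal_mul (hw0 s), ENNReal.ofReal_toReal (measure_ne_top _ _)]
  let ν : Measure I := ∑ s : S, W s • Measure.dirac (s : I)
  have hνA {A : Set I} (hA : MeasurableSet A) : ν A = ∑ s : S, W s * A.indicator 1 (s : I) := by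
    simp [ν, Measure.dirac_apply' _ hA]
  have hprob : IsProbabilityMeasure ν := by
    refine ⟨?_⟩
    rw [hνA MeasurableSet.univ]
    simp only [indicator_univ, Pi.one_apply, mul_one, W]
    rw [← ENNReal.ofReal_sum_of_nonneg fun s _ => hw0 s, hw1, ENNReal.ofReal_one]
  refine ⟨ν, ⟨hprob, ?_⟩, Measure.support_subset_of_isClosed hS.isClosed ?_⟩
  · ext A hA
    have hind (s : S) (g : C(I, I)) : (g ⁻¹' A).indicator (1 : I → ℝ≥0∞) s
        = {g : C(I, I) | g s ∈ A}.indicator 1 g := rfl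
    rw [conv_apply μ ν hA]
    simp only [hνA (ContinuousMap.measurable _ hA), hind]
    rw [lintegral_finsetSum (f := fun (s : S) g => W s * {g : C(I, I) | g s ∈ A}.indicator 1 g) _
      fun s _ => (measurable_one.indicator (hset s hA)).const_mul _]
    have hs (s : S) : ∫⁻ g, W s * {g : C(I, I) | g s ∈ A}.indicator 1 g ∂μ
        = ∑ t : S, W s * q s t * A.indicator 1 (t : I) := by
      rw [lintegral_const_mul _ (measurable_one.indicator (hset s hA)),
        lintegral_indicator_one (hset s hA), hqA s hA, Finset.mul_sum]
      exact Finset.sum_congr rfl fun t _ => by ring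
    simp only [hs]
    rw [Finset.sum_comm, hνA hA]
    simp only [← Finset.sum_mul, hW]
  · rw [mem_ae_iff, hνA hS.measurableSet.compl]
    simp

end StochDyn

theorem theorem1p1 [MeasurableSpace C(I, I)] [BorelSpace C(I, I)]
    (μ : Measure C(I, I)) [IsProbabilityMeasure μ] (hBV : StochDyn.HasBV μ) :
    (∀ ν₁ ν₂ : Measure I,
      StochDyn.IsErgodic μ ν₁ → StochDyn.ConcentratedOnIoo ν₁ →
      StochDyn.IsErgodic μ ν₂ → StochDyn.ConcentratedOnIoo ν₂ →
      (({0, 1} : Set I) ∩ ν₁.support ∩ ν₂.support).Nonempty → ν₁ = ν₂) ∧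
    ((¬ ∃ ν : Measure I, StochDyn.IsStationary μ ν ∧
        ν.support.Finite ∧ ν.support ⊆ Ioo (0 : I) 1) →
      ∀ ν₁ ν₂ : Measure I,
        StochDyn.IsErgodic μ ν₁ → StochDyn.ConcentratedOnIoo ν₁ →
        StochDyn.IsErgodic μ ν₂ → StochDyn.ConcentratedOnIoo ν₂ →
        ν₁ ≠ ν₂ → ν₁.support ∩ ν₂.support = ∅) := by
  refine ⟨fun ν₁ ν₂ h₁ hc₁ h₂ hc₂ => ?_, fun hfin ν₁ ν₂ h₁ hc₁ h₂ hc₂ hne => ?_⟩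
  · rintro ⟨x, ⟨hx01, hx₁⟩, hx₂⟩
    by_contra hne
    have hx := StochDyn.mem_Ioo_of_mem_support hBV h₁ hc₁ h₂ hc₂ hne hx₁ hx₂
    rcases hx01 with rfl | rfl
    · exact lt_irrefl _ hx.1
    · exact lt_irrefl _ hx.2
  · by_contra hS
    have hSfin := StochDyn.finite_inter_support hBV h₁ h₂ hne
    obtain ⟨ν, hν, hνS⟩ := StochDyn.exists_isStationary_of_finite hSfin
      (nonempty_iff_ne_empty.2 hS) (by
        filter_upwards [h₁.isStationary.ae_mapsTo_support, h₂.isStationary.ae_mapsTo_support]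
          with g hg₁ hg₂ using hg₁.inter_inter hg₂)
    exact hfin ⟨ν, hν, hSfin.subset hνS, fun x hx =>
      StochDyn.mem_Ioo_of_mem_support hBV h₁ hc₁ h₂ hc₂ hne (hνS hx).1 (hνS hx).2⟩
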